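/- Let $\mathcal H$ and $\mathcal K$ be complex Hilbert spaces and let $F$ be a rigging, i.e. a closed densely defined operator from $\mathcal H$ to $\mathcal K$ with zero kernel and zero co-kernel (dense range). Let $H_0$ be a self-adjoint operator on $\mathcal H$ compatible with $F$, i.e. such that $F(1+|H_0|)^{-1/2}$ is everywhere defined and compact. Let $\mathcal A$ be the real affine space of all self-adjoint operators $H=H_0+F^*JF$, where $J$ runs over the bounded self-adjoint operators on $\mathcal K$ and the sum is taken in the sense of quadratic forms: $\operatorname{dom}H\subset\operatorname{dom}|H_0|^{1/2}$ and $\langle Hf,g\rangle=\langle f,H_0g\rangle+\langle JFf,Fg\rangle$ for all $f\in\operatorname{dom}H$, $g\in\operatorname{dom}H_0$. For $H\in\mathcal A$ and an open set $O\subset\mathbb R$ let $E_O(H)$ be the spectral projection of $H$, and let $\operatorname{ran}FE_O(H)=\{Fg : g\in\operatorname{ran}E_O(H)\cap\operatorname{dom}F\}$. A real number $\lambda$ is called (I)-singular if it is an eigenvalue of infinite multiplicity of some $H\in\mathcal A$, and (F)-singular if for some $H\in\mathcal A$ $$\dim\bigcap_{O\ni\lambda}\overline{\operatorname{ran}FE_O(H)}=\infty,$$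 the intersection being over all open sets $O$ containing $\lambda$. **Theorem.** Let $\lambda\in\mathbb R$. If $\lambda$ is an eigenvalue of infinite multiplicity of $H\in\mathcal A$ with eigenspace $\mathcal V_\lambda$, then $\mathcal V_\lambda\subset\operatorname{dom}F$, $F\mathcal V_\lambda\subset\bigcap_{O\ni\lambda}\overline{\operatorname{ran}FE_O(H)}$, and this intersection is infinite-dimensional. In particular, any (I)-singular real number is (F)-singular. -/

import Mathlib

noncomputable section

namespace RiggedHilbert

variable {E : Type*} [NormedAddCommGroup E] [InnerProductSpace ℂ E] [CompleteSpace E]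
variable {K : Type*} [NormedAddCommGroup K] [InnerProductSpace ℂ K] [CompleteSpace K]

/-- `R = (T - z)⁻¹` : the bounded operator `R` is the (everywhere defined, two-sided) inverse of the
possibly unbounded operator `T - z`. -/
def IsResolventAt (T : E →ₗ.[ℂ] E) (z : ℂ) (R : E →L[ℂ] E) : Prop :=
  ∀ x y : E, R x = y ↔ ∃ hy : y ∈ T.domain, T ⟨y, hy⟩ - z • y = x

theorem inner_self_adjoint {T : E →ₗ.[ℂ] E} (hT : IsSelfAdjoint T) (x y : T.domain) :
    inner ℂ (T x) (y : E) = inner ℂ (x : E) (T y) := by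
  have h := LinearPMap.adjoint_isFormalAdjoint (T := T) hT.dense_domain
  rw [LinearPMap.isSelfAdjoint_def.mp hT] at h
  exact h x y

theorem norm_sub_I {T : E →ₗ.[ℂ] E} (hT : IsSelfAdjoint T) (x : T.domain) :
    ‖T x - Complex.I • (x : E)‖ ^ 2 = ‖T x‖ ^ 2 + ‖(x : E)‖ ^ 2 := by
  have h := inner_self_adjoint hT x x
  have him : (inner ℂ (T x) (x : E) : ℂ).im = 0 := by
    have h2 := inner_conj_symm (𝕜 := ℂ) (T x) (x : E)
    rw [← h] at h2
    exact Complex.conj_eq_iff_im.mp h2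
  rw [@norm_sub_sq ℂ, inner_smul_right, norm_smul]
  simp [him]

theorem mem_domain_of_inner {T : E →ₗ.[ℂ] E} (hT : IsSelfAdjoint T) {y w : E}
    (h : ∀ x : T.domain, inner ℂ w (x : E) = inner ℂ y (T x)) :
    ∃ hy : y ∈ T.domain, T ⟨y, hy⟩ = w := by
  have h1 : ∃ hy : y ∈ (LinearPMap.adjoint T).domain, (LinearPMap.adjoint T) ⟨y, hy⟩ = w :=
    ⟨LinearPMap.mem_adjoint_domain_of_exists y ⟨w, h⟩,
      LinearPMap.adjoint_apply_eq hT.dense_domain _ h⟩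
  rwa [LinearPMap.isSelfAdjoint_def.mp hT] at h1

/-- For a self-adjoint `T` the resolvent `(T - i)⁻¹` exists. -/
theorem exists_resolvent {T : E →ₗ.[ℂ] E} (hT : IsSelfAdjoint T) :
    ∃ R : E →L[ℂ] E, IsResolventAt T Complex.I R := by
  let S : T.domain →ₗ[ℂ] E := T.toFun - Complex.I • T.domain.subtype
  have hS : ∀ x, S x = T x - Complex.I • (x : E) := fun x => rfl
  have hle : ∀ x : T.domain, ‖(x : E)‖ ≤ 1 * ‖S x‖ := fun x => by
    rw [one_mul, ← abs_norm, ← abs_norm (S x), ← sq_le_sq, hS, norm_sub_I hT]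
    nlinarith [sq_nonneg ‖T x‖]
  have hinj : Function.Injective S := by
    rw [injective_iff_map_eq_zero]
    intro x hx
    have := hle x
    rw [hx, norm_zero, mul_zero, norm_le_zero_iff] at this
    exact Subtype.ext this
  have hclosed : IsClosed (LinearMap.range S : Set E) := by
    have hg : IsClosed (T.graph : Set (E × E)) := hT.isClosed
    let G : T.graph →ₗ[ℂ] E := (LinearMap.snd ℂ E E - Complex.I • LinearMap.fst ℂ E E).comp
      T.graph.subtype
    have : CompleteSpace T.graph := hg.completeSpace_coe
    have hGc : Continuous G := by
      have h1 : ⇑G = fun p : T.graph => (p : E × E).2 - Complex.I • (p : E × E).1 := rfl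
      rw [h1]; fun_prop
    have hG : AntilipschitzWith 1 G := by
      refine AddMonoidHomClass.antilipschitz_of_bound G fun p => ?_
      obtain ⟨y, hy1, hy2⟩ := T.mem_graph_iff.mp p.2
      have h1 : G p = S y := by
        change (p : E × E).2 - Complex.I • (p : E × E).1 = _
        rw [← hy1, ← hy2, hS]
      rw [h1, Submodule.coe_norm, Prod.norm_def, NNReal.coe_one, one_mul]
      refine max_le ?_ ?_
      · rw [← hy1]; simpa using hle y
      · rw [← hy2, ← abs_norm, ← abs_norm (S y), ← sq_le_sq, hS, norm_sub_I hT]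
        nlinarith [sq_nonneg ‖(y : E)‖]
    have hr : (LinearMap.range S : Set E) = Set.range G := by
      ext w
      constructor
      · rintro ⟨y, rfl⟩
        exact ⟨⟨_, T.mem_graph y⟩, rfl⟩
      · rintro ⟨p, rfl⟩
        obtain ⟨y, hy1, hy2⟩ := T.mem_graph_iff.mp p.2
        refine ⟨y, ?_⟩
        change _ = (p : E × E).2 - Complex.I • (p : E × E).1
        rw [← hy1, ← hy2, hS]
    rw [hr]
    exact hG.isClosed_range (LipschitzWith.uniformContinuous
      (G.mkContinuousOfExistsBound ⟨2, fun p => by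
        change ‖(p : E × E).2 - Complex.I • (p : E × E).1‖ ≤ _
        refine (norm_sub_le _ _).trans ?_
        rw [norm_smul, Complex.norm_I, one_mul, Submodule.coe_norm, two_mul]
        exact add_le_add (norm_snd_le _) (norm_fst_le _)⟩).lipschitz)
  have htop : LinearMap.range S = ⊤ := by
    have hd : (LinearMap.range S)ᗮ = ⊥ := by
      rw [eq_bot_iff]
      intro y hy
      have hw : ∀ x : T.domain, inner ℂ ((-Complex.I) • y) (x : E) = inner ℂ y (T x) := fun x => by
        have := (Submodule.mem_orthogonal' _ _).mp hy (S x) ⟨x, rfl⟩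
        rw [hS, inner_sub_right, inner_smul_right] at this
        rw [inner_smul_left, map_neg, Complex.conj_I]
        linear_combination -this
      obtain ⟨hyd, hTy⟩ := mem_domain_of_inner hT hw
      have h1 := norm_sub_I hT ⟨y, hyd⟩
      rw [hTy, ← sub_smul, norm_smul, norm_smul, mul_pow, mul_pow] at h1
      have h2 : ‖-Complex.I - Complex.I‖ = 2 := by
        rw [← neg_add', norm_neg, ← two_mul]; simp
      rw [h2, norm_neg, Complex.norm_I] at h1
      have h3 : ‖y‖ = 0 := by nlinarith [norm_nonneg y]
      exact norm_eq_zero.mp h3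
    have h4 := (Submodule.topologicalClosure_eq_top_iff (K := LinearMap.range S)).mpr hd
    rwa [IsClosed.submodule_topologicalClosure_eq hclosed] at h4
  let e : T.domain ≃ₗ[ℂ] E := LinearEquiv.ofBijective S ⟨hinj, LinearMap.range_eq_top.mp htop⟩
  have he : ∀ x, S (e.symm x) = x := fun x => e.apply_symm_apply x
  refine ⟨(T.domain.subtype.comp e.symm.toLinearMap).mkContinuous 1 fun x => ?_, fun x y => ?_⟩
  · have := hle (e.symm x)
    rwa [he] at this
  · change ((e.symm x : T.domain) : E) = y ↔ _
    constructor
    · rintro rfl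
      exact ⟨(e.symm x).2, he x⟩
    · rintro ⟨hy, h⟩
      have : e.symm x = ⟨y, hy⟩ := hinj ((he x).trans h.symm)
      rw [this]

/-- The bounded operator `(T - i)⁻¹`; it exists for every self-adjoint `T` by `exists_resolvent`. -/
def resolventI (T : E →ₗ.[ℂ] E) : E →L[ℂ] E := by
  classical
  exact if h : ∃ R : E →L[ℂ] E, IsResolventAt T Complex.I R then h.choose else 0

theorem resolventI_spec {T : E →ₗ.[ℂ] E} (hT : IsSelfAdjoint T) :
    IsResolventAt T Complex.I (resolventI T) := by
  have h := exists_resolvent hT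
  unfold resolventI
  rw [dif_pos h]
  exact h.choose_spec

/-- The continuous functional calculus `φ(T)` of a self-adjoint operator `T`, for a continuous
function `φ` on the real line vanishing at infinity. It is obtained from Mathlib's functional
calculus of the bounded normal operator `R = (T - i)⁻¹`: the point `x` of the spectrum of `T`
corresponds to the point `w = (x - i)⁻¹` of the spectrum of `R`, so that `x = Re w⁻¹`, and `w = 0`
corresponds to `x = ∞`. -/
def funCalc (T : E →ₗ.[ℂ] E) (φ : ℝ → ℂ) : E →L[ℂ] E :=
  cfc (fun w : ℂ => if w = 0 then 0 else φ (w⁻¹).re) (resolventI T)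

/-- The range of the spectral projection `E_O(T)` of an open set `O`. If `φ_n` are continuous with
compact support in `O` and increase to the indicator function of `O`, then `φ_n(T)` converges
strongly to `E_O(T)`; hence the range of `E_O(T)` is the closed linear span of the ranges of `φ(T)`,
`φ` continuous with compact support contained in `O`. -/
def spectralSubspace (T : E →ₗ.[ℂ] E) (O : TopologicalSpace.Opens ℝ) : Submodule ℂ E :=
  (⨆ (φ : ℝ → ℂ) (_ : Continuous φ ∧ HasCompactSupport φ ∧ tsupport φ ⊆ O),
    LinearMap.range (funCalc T φ : E →ₗ[ℂ] E)).topologicalClosure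

/-- The spectral projection `E_O(T)` of a self-adjoint operator `T` for an open set `O`. -/
def spectralProj (T : E →ₗ.[ℂ] E) (O : TopologicalSpace.Opens ℝ) : E →L[ℂ] E :=
  haveI : CompleteSpace (spectralSubspace T O) :=
    (Submodule.isClosed_topologicalClosure _).completeSpace_coe
  (spectralSubspace T O).starProjection

/-- The eigenspace of a possibly unbounded operator. -/
def eigenspace (T : E →ₗ.[ℂ] E) (μ : ℂ) : Submodule ℂ E where
  carrier := {f | ∃ hf : f ∈ T.domain, T ⟨f, hf⟩ = μ • f}
  zero_mem' := ⟨T.domain.zero_mem, by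
    rw [smul_zero]; exact T.map_zero⟩
  add_mem' := by
    rintro a b ⟨ha, ha'⟩ ⟨hb, hb'⟩
    refine ⟨T.domain.add_mem ha hb, ?_⟩
    rw [smul_add, ← ha', ← hb', ← T.map_add]
    rfl
  smul_mem' := by
    rintro c a ⟨ha, ha'⟩
    refine ⟨T.domain.smul_mem c ha, ?_⟩
    rw [smul_comm, ← ha', ← T.map_smul]
    rfl

/-- A rigging of the Hilbert space `E`: a closed densely defined operator `F` from `E` to an
auxiliary Hilbert space `K` with zero kernel and zero co-kernel (that is, with dense range). -/
structure IsRigging (F : E →ₗ.[ℂ] K) : Prop where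
  dense_domain : Dense (F.domain : Set E)
  isClosed : F.IsClosed
  ker_eq_zero : ∀ f : F.domain, F f = 0 → f = 0
  dense_range : Dense (Set.range F)

/-- The bounded operator `(1 + |T|)^{-1/2}`. -/
def invSqrtOneAddAbs (T : E →ₗ.[ℂ] E) : E →L[ℂ] E :=
  funCalc T fun x => (((Real.sqrt (1 + |x|))⁻¹ : ℝ) : ℂ)

/-- `F` is `|T|^{1/2}`-compact: the operator `F (1 + |T|)^{-1/2}` is everywhere defined and
compact. -/
def IsCompatible (F : E →ₗ.[ℂ] K) (T : E →ₗ.[ℂ] E) : Prop :=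
  ∃ C : E →L[ℂ] K, IsCompactOperator C ∧
    ∀ f : E, ∃ hf : invSqrtOneAddAbs T f ∈ F.domain, F ⟨invSqrtOneAddAbs T f, hf⟩ = C f

/-- The form domain `dom |T|^{1/2} = ran (1 + |T|)^{-1/2}` of a self-adjoint operator `T`. -/
def formDomain (T : E →ₗ.[ℂ] E) : Submodule ℂ E :=
  LinearMap.range (invSqrtOneAddAbs T : E →ₗ[ℂ] E)

/-- The self-adjoint operator `H` is the perturbed operator `H₀ + F* J F`, the sum being understood
in the sense of quadratic forms since `F` may be unbounded: the domain of `H` lies in the form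
domain of `H₀`, and `⟪H f, g⟫ = ⟪f, H₀ g⟫ + ⟪J F f, F g⟫` for all `f` in the domain of `H` and all
`g` in the domain of `H₀` (which is a form core). When `F` is bounded this says that
`H = H₀ + F* J F` as an operator sum. -/
structure IsPerturbation (F : E →ₗ.[ℂ] K) (H₀ : E →ₗ.[ℂ] E) (J : K →L[ℂ] K) (H : E →ₗ.[ℂ] E) :
    Prop where
  isSelfAdjoint : IsSelfAdjoint H
  domain_le : H.domain ≤ formDomain H₀
  form_eq : ∀ (f : H.domain) (g : H₀.domain) (u v : F.domain), (u : E) = f → (v : E) = g →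
    inner ℂ (H f) (g : E) = inner ℂ (f : E) (H₀ g) + inner ℂ (J (F u)) (F v)

/-- The real affine space `𝒜` of all operators `H₀ + F* J F`, where `J` runs over the bounded
self-adjoint operators on the auxiliary Hilbert space. -/
def affineSpace (F : E →ₗ.[ℂ] K) (H₀ : E →ₗ.[ℂ] E) : Set (E →ₗ.[ℂ] E) :=
  {H | ∃ J : K →L[ℂ] K, IsSelfAdjoint J ∧ IsPerturbation F H₀ J H}

/-- The range of the product `F E_O(H)`, taken on its natural domain `{f | E_O(H) f ∈ dom F}`. -/
def ranFE (F : E →ₗ.[ℂ] K) (H : E →ₗ.[ℂ] E) (O : TopologicalSpace.Opens ℝ) : Submodule ℂ K :=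
  ((LinearMap.range (spectralProj H O : E →ₗ[ℂ] E)).comap F.domain.subtype).map F.toFun

/-- The intersection of the closures of `ran F E_O(H)` over all open sets `O` containing `a`. -/
def regEigenspace (F : E →ₗ.[ℂ] K) (H : E →ₗ.[ℂ] E) (a : ℝ) : Submodule ℂ K :=
  ⨅ (O : TopologicalSpace.Opens ℝ) (_ : a ∈ O), (ranFE F H O).topologicalClosure

/-- `a` is (I)-singular: an eigenvalue of infinite multiplicity of some `H ∈ 𝒜`. -/
def IsISingular (F : E →ₗ.[ℂ] K) (H₀ : E →ₗ.[ℂ] E) (a : ℝ) : Prop :=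
  ∃ H ∈ affineSpace F H₀, ¬ FiniteDimensional ℂ (eigenspace H (a : ℂ))

/-- `a` is (F)-singular. -/
def IsFSingular (F : E →ₗ.[ℂ] K) (H₀ : E →ₗ.[ℂ] E) (a : ℝ) : Prop :=
  ∃ H ∈ affineSpace F H₀, ¬ FiniteDimensional ℂ (regEigenspace F H a)

end RiggedHilbert

end

/-! An eigenvector `f` of `H` at `a` lies in `dom H`, hence in the form domain of `H₀`, which
compatibility places inside `dom F`. For every open `O` containing `a` the spectral projection fixes
`f`, so `F f` lies in `ran F E_O(H)` even before closures are taken. Since `F` is injective, an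
infinite-dimensional eigenspace forces an infinite-dimensional intersection.

The work is in showing that the projection fixes `f`. It is built from the functional calculus of
the normal operator `R = (H - i)⁻¹`, for which `f` has eigenvalue `(a - i)⁻¹`; one needs `φ(H) f =
φ(a) f` (`funCalc_apply_of_mem_eigenspace`), and then a bump function at `a`. -/

namespace RiggedHilbert

/-! ### Eigenvectors under the functional calculus of a bounded normal operator -/

section BoundedNormal

variable {E : Type*} [NormedAddCommGroup E] [InnerProductSpace ℂ E]

theorem mem_spectrum_of_apply_eq_smul {R : E →L[ℂ] E} {f : E} {w : ℂ} (hf0 : f ≠ 0)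
    (hf : R f = w • f) : w ∈ spectrum ℂ R := by
  rw [spectrum.mem_iff]
  rintro ⟨u, hu⟩
  apply hf0
  have h : (u : E →L[ℂ] E) f = 0 := by
    simp [hu, Algebra.algebraMap_eq_smul_one, hf]
  have h2 : ((↑u⁻¹ : E →L[ℂ] E) * (u : E →L[ℂ] E)) f = f := by
    rw [Units.inv_mul]; rfl
  rw [← h2, mul_apply_eq_comp, h, map_zero]

variable [CompleteSpace E]

/-- An eigenvector of a normal operator is an eigenvector of its adjoint. -/
theorem star_apply_of_apply_eq_smul {R : E →L[ℂ] E} (hR : IsStarNormal R) {f : E} {w : ℂ}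
    (hf : R f = w • f) : (star R) f = star w • f := by
  have hN : IsStarNormal (R - algebraMap ℂ (E →L[ℂ] E) w) := by
    refine ⟨?_⟩
    rw [star_sub, ← algebraMap_star_comm]
    exact (hR.star_comm_self.sub_right (Algebra.commutes _ _).symm).sub_left
      (Algebra.commutes _ _)
  have h := (ContinuousLinearMap.isStarNormal_iff_norm_eq_adjoint.mp hN) f
  rw [← ContinuousLinearMap.star_eq_adjoint, star_sub, ← algebraMap_star_comm] at h
  simp only [sub_apply, Algebra.algebraMap_eq_smul_one,
    smul_apply, one_apply_eq_self, hf, sub_self, norm_zero] at h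
  exact sub_eq_zero.mp (norm_eq_zero.mp h.symm)

/-- The continuous functional calculus of a normal operator acts on an eigenvector by evaluation at
the eigenvalue. -/
theorem cfc_apply_of_apply_eq_smul {R : E →L[ℂ] E} (hR : IsStarNormal R) {f : E} {w : ℂ}
    (hf0 : f ≠ 0) (hf : R f = w • f) {g : ℂ → ℂ} (hg : ContinuousOn g (spectrum ℂ R)) :
    cfc g R f = g w • f := by
  have hw := mem_spectrum_of_apply_eq_smul hf0 hf
  rw [cfc_apply g R hR hg]
  suffices ∀ h : C(spectrum ℂ R, ℂ), cfcHom hR h f = h ⟨w, hw⟩ • f from this _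
  intro h
  induction h using ContinuousMap.induction_on_of_compact with
  | const r =>
    have : ContinuousMap.const (spectrum ℂ R) r = algebraMap ℂ C(spectrum ℂ R, ℂ) r := rfl
    rw [this, AlgHomClass.commutes]
    simp [Algebra.algebraMap_eq_smul_one]
  | id => rw [cfcHom_id]; exact hf
  | star_id =>
    rw [map_star, cfcHom_id]
    exact star_apply_of_apply_eq_smul hR hf
  | add p q hp hq => simp [hp, hq, add_smul]
  | mul p q hp hq => simp [hp, hq, mul_smul, smul_comm (p _)]
  | frequently p hp =>
    have hclosed : IsClosed {p : C(spectrum ℂ R, ℂ) | cfcHom hR p f = p ⟨w, hw⟩ • f} :=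
      isClosed_eq ((ContinuousLinearMap.apply ℂ E f).continuous.comp (cfcHom_continuous hR))
        ((ContinuousEvalConst.continuous_eval_const _).smul continuous_const)
    exact hclosed.mem_of_frequently_of_tendsto hp Filter.tendsto_id

end BoundedNormal

/-! ### The resolvent at `i` and the spectral subspaces of a self-adjoint operator -/

section Resolvent

variable {E : Type*} [NormedAddCommGroup E] [InnerProductSpace ℂ E]

theorem IsResolventAt.apply_of_mem_eigenspace {T : E →ₗ.[ℂ] E} {R : E →L[ℂ] E} {z μ : ℂ}
    (hR : IsResolventAt T z R) (hμ : μ ≠ z) {f : E} (hf : f ∈ eigenspace T μ) :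
    R f = (μ - z)⁻¹ • f := by
  obtain ⟨hfd, hTf⟩ := hf
  have h : R ((μ - z) • f) = f := (hR _ _).mpr ⟨hfd, by rw [hTf, sub_smul]⟩
  rw [map_smul] at h
  rw [eq_inv_smul_iff₀ (sub_ne_zero.mpr hμ), h]

variable [CompleteSpace E]

/-- The Cayley transform `(T + i)(T - i)⁻¹` of a self-adjoint operator is unitary. -/
theorem IsResolventAt.cayley_mem_unitary {T : E →ₗ.[ℂ] E} (hT : IsSelfAdjoint T) {R : E →L[ℂ] E}
    (hR : IsResolventAt T Complex.I R) :
    1 + (2 * Complex.I) • R ∈ unitary (E →L[ℂ] E) := by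
  set U : E →L[ℂ] E := 1 + (2 * Complex.I) • R with hU
  have hUx (y : T.domain) : U (T y - Complex.I • (y : E)) = T y + Complex.I • (y : E) := by
    have h : R (T y - Complex.I • (y : E)) = y := (hR _ _).mpr ⟨y.2, rfl⟩
    simp only [hU, add_apply, one_apply_eq_self,
      smul_apply, h]
    module
  have hsurj (x : E) : ∃ y : T.domain, T y - Complex.I • (y : E) = x := by
    obtain ⟨hy, h⟩ := (hR x (R x)).mp rfl
    exact ⟨⟨_, hy⟩, h⟩
  have h1 : star U * U = 1 := by
    refine ContinuousLinearMap.ext fun x => ext_inner_right ℂ fun x' => ?_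
    rw [mul_apply_eq_comp, ContinuousLinearMap.star_eq_adjoint,
      ContinuousLinearMap.adjoint_inner_left, one_apply_eq_self]
    obtain ⟨y, rfl⟩ := hsurj x
    obtain ⟨y', rfl⟩ := hsurj x'
    rw [hUx, hUx]
    have h := inner_self_adjoint hT y y'
    simp only [inner_add_left, inner_add_right, inner_sub_left, inner_sub_right, inner_smul_left,
      inner_smul_right, Complex.conj_I, h]
    ring
  have hinj (z : E) (hz : star U z = 0) : z = 0 := by
    have hw (y : T.domain) : inner ℂ (Complex.I • z) (y : E) = inner ℂ z (T y) := by
      have h : inner ℂ (star U z) (T y - Complex.I • (y : E)) = 0 := by rw [hz, inner_zero_left]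
      rw [ContinuousLinearMap.star_eq_adjoint, ContinuousLinearMap.adjoint_inner_left, hUx,
        inner_add_right, inner_smul_right] at h
      rw [inner_smul_left, Complex.conj_I]
      linear_combination -h
    obtain ⟨hzd, hTz⟩ := mem_domain_of_inner hT hw
    have h := norm_sub_I hT ⟨z, hzd⟩
    rw [hTz, sub_self, norm_zero] at h
    have h3 : ‖z‖ = 0 := by nlinarith [norm_nonneg z, sq_nonneg ‖Complex.I • z‖]
    exact norm_eq_zero.mp h3
  refine Unitary.mem_iff.mpr ⟨h1, ContinuousLinearMap.ext fun x => ?_⟩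
  -- `U*` kills `U U* x - x` because `U* U = 1`.
  refine sub_eq_zero.mp (hinj _ ?_)
  rw [map_sub, ← mul_apply_eq_comp, ← mul_assoc, h1, one_mul,
    one_apply_eq_self, sub_self]

/-- In `U* U = U U*` the constant and linear terms cancel, leaving `4 R* R = 4 R R*`. -/
theorem IsResolventAt.isStarNormal {T : E →ₗ.[ℂ] E} (hT : IsSelfAdjoint T) {R : E →L[ℂ] E}
    (hR : IsResolventAt T Complex.I R) : IsStarNormal R := by
  obtain ⟨h1, h2⟩ := Unitary.mem_iff.mp (hR.cayley_mem_unitary hT)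
  have h := h1.trans h2.symm
  simp only [star_add, star_one, star_smul, add_mul, mul_add, one_mul, mul_one, smul_mul_assoc,
    mul_smul_comm, smul_add, smul_smul] at h
  have h4 : (star (2 * Complex.I) * (2 * Complex.I)) = 4 := by
    simp only [star_mul', Complex.star_def, Complex.conj_I, map_ofNat]
    linear_combination -4 * Complex.I_mul_I
  rw [mul_comm (2 * Complex.I) (star (2 * Complex.I)), h4] at h
  have h5 : (4 : ℂ) • (star R * R) = (4 : ℂ) • (R * star R) := by
    rw [← sub_eq_zero] at h ⊢
    rw [← h]; abel
  have h6 : (4 : ℂ) ≠ 0 := by norm_num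
  exact ⟨smul_right_injective (E →L[ℂ] E) h6 h5⟩

/-- The spectrum of `(T - i)⁻¹` lies on the circle which is the image of the real line. -/
theorem IsResolventAt.inv_im_of_mem_spectrum {T : E →ₗ.[ℂ] E} (hT : IsSelfAdjoint T)
    {R : E →L[ℂ] E} (hR : IsResolventAt T Complex.I R) {w : ℂ} (hw : w ∈ spectrum ℂ R)
    (hw0 : w ≠ 0) : (w⁻¹).im = -1 := by
  have h2I : (2 * Complex.I) ≠ 0 := mul_ne_zero two_ne_zero Complex.I_ne_zero
  have h1 : (2 * Complex.I) • w ∈ spectrum ℂ ((2 * Complex.I) • R) :=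
    (spectrum.smul_mem_smul_iff (r := Units.mk0 _ h2I)).mpr hw
  have h2 : (2 * Complex.I) • w + 1 ∈ spectrum ℂ (1 + (2 * Complex.I) • R) := by
    have := (spectrum.add_mem_add_iff (s := (1 : ℂ))).mpr h1
    rwa [map_one] at this
  have h3 := spectrum.norm_eq_one_of_unitary (hR.cayley_mem_unitary hT) h2
  have h4 : Complex.normSq ((2 * Complex.I) • w + 1) = 1 := by
    rw [Complex.normSq_eq_norm_sq, h3, one_pow]
  have h5 : Complex.normSq w ≠ 0 := fun h => hw0 (Complex.normSq_eq_zero.mp h)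
  rw [Complex.inv_im, div_eq_iff h5]
  simp only [Complex.normSq_apply, smul_eq_mul, Complex.add_re, Complex.add_im, Complex.mul_re,
    Complex.mul_im, Complex.I_re, Complex.I_im, Complex.one_re, Complex.one_im, Complex.re_ofNat,
    Complex.im_ofNat] at h4 ⊢
  linarith

/-- Only `w = 0` is delicate. On the spectrum `Im w⁻¹ = -1`, so `w → 0` forces `|Re w⁻¹| → ∞`,
beyond the support of `φ`; off this circle the claim could fail. -/
theorem IsResolventAt.continuousOn_spectrum {T : E →ₗ.[ℂ] E} (hT : IsSelfAdjoint T)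
    {R : E →L[ℂ] E} (hR : IsResolventAt T Complex.I R) {φ : ℝ → ℂ} (hφ : Continuous φ)
    (hφc : HasCompactSupport φ) :
    ContinuousOn (fun w : ℂ => if w = 0 then 0 else φ (w⁻¹).re) (spectrum ℂ R) := by
  intro w _
  rcases eq_or_ne w 0 with rfl | hw0
  · obtain ⟨M, hM⟩ := hφc.isCompact.isBounded.subset_closedBall (0 : ℝ)
    have hM' (x : ℝ) (hx : φ x ≠ 0) : |x| ≤ M := by
      simpa using hM (subset_tsupport φ hx)
    refine ContinuousWithinAt.congr_of_eventuallyEq (f := fun _ => (0 : ℂ))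
      continuousWithinAt_const ?_ (by simp)
    -- In this ball `|v⁻¹| > |M| + 2`, whereas `|Re v⁻¹| ≤ M` would give `|v⁻¹| ≤ M + 1`.
    have hball : Metric.ball (0 : ℂ) (|M| + 2)⁻¹ ∈ nhds (0 : ℂ) :=
      Metric.ball_mem_nhds _ (by positivity)
    filter_upwards [self_mem_nhdsWithin, mem_nhdsWithin_of_mem_nhds hball] with v hv hvb
    split_ifs with hv0
    · rfl
    by_contra hne
    have h1 := hM' _ hne
    have h2 := hR.inv_im_of_mem_spectrum hT hv hv0
    have h3 := Complex.norm_le_abs_re_add_abs_im v⁻¹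
    rw [h2, abs_neg, abs_one] at h3
    rw [mem_ball_zero_iff, lt_inv_comm₀ (norm_pos_iff.mpr hv0) (by positivity), ← norm_inv] at hvb
    linarith [le_abs_self M]
  · have h : ContinuousAt (fun w : ℂ => φ (w⁻¹).re) w :=
      hφ.continuousAt.comp (Complex.continuous_re.continuousAt.comp (continuousAt_inv₀ hw0))
    refine (h.congr ?_).continuousWithinAt
    filter_upwards [isOpen_ne.mem_nhds hw0] with v hv
    rw [if_neg hv]

theorem funCalc_apply_of_mem_eigenspace {T : E →ₗ.[ℂ] E} (hT : IsSelfAdjoint T) {a : ℝ} {f : E}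
    (hf : f ∈ eigenspace T (a : ℂ)) {φ : ℝ → ℂ} (hφ : Continuous φ) (hφc : HasCompactSupport φ) :
    funCalc T φ f = φ a • f := by
  rcases eq_or_ne f 0 with rfl | hf0
  · simp
  have hR := resolventI_spec hT
  have haI : (a : ℂ) ≠ Complex.I := fun h => by simpa using congrArg Complex.im h
  have hRf := hR.apply_of_mem_eigenspace haI hf
  have h := cfc_apply_of_apply_eq_smul (hR.isStarNormal hT) hf0 hRf
    (hR.continuousOn_spectrum hT hφ hφc)
  rw [if_neg (inv_ne_zero (sub_ne_zero.mpr haI)), inv_inv] at h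
  simpa [funCalc] using h

/-- A bump function `u` supported in `O` with `u a = 1` gives `u(T) f = f`. -/
theorem eigenspace_le_spectralSubspace {T : E →ₗ.[ℂ] E} (hT : IsSelfAdjoint T) {a : ℝ}
    {O : TopologicalSpace.Opens ℝ} (ha : a ∈ O) :
    eigenspace T (a : ℂ) ≤ spectralSubspace T O := by
  intro f hf
  obtain ⟨u, hu1, hu2, hu3, -, hu5⟩ :=
    exists_contDiff_tsupport_subset (n := 0) (O.isOpen.mem_nhds ha)
  have hc : Continuous fun x => (u x : ℂ) := Complex.continuous_ofReal.comp hu3.continuous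
  have hs : HasCompactSupport fun x => (u x : ℂ) := hu2.comp_left Complex.ofReal_zero
  have ht : tsupport (fun x => (u x : ℂ)) ⊆ O :=
    (tsupport_comp_subset Complex.ofReal_zero u).trans hu1
  have h := funCalc_apply_of_mem_eigenspace hT hf hc hs
  rw [hu5, Complex.ofReal_one, one_smul] at h
  refine Submodule.le_topologicalClosure _ ?_
  exact Submodule.mem_iSup_of_mem _ (Submodule.mem_iSup_of_mem ⟨hc, hs, ht⟩ ⟨f, h⟩)

theorem spectralProj_apply_of_mem {T : E →ₗ.[ℂ] E} {O : TopologicalSpace.Opens ℝ} {f : E}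
    (hf : f ∈ spectralSubspace T O) : spectralProj T O f = f := by
  have : CompleteSpace (spectralSubspace T O) :=
    (Submodule.isClosed_topologicalClosure _).completeSpace_coe
  exact Submodule.starProjection_eq_self_iff.mpr hf

end Resolvent

/-! ### Transport of the eigenspace by the rigging -/

section Rigging

variable {E : Type*} [NormedAddCommGroup E] [InnerProductSpace ℂ E] [CompleteSpace E]
variable {K : Type*} [NormedAddCommGroup K] [InnerProductSpace ℂ K]

theorem IsCompatible.formDomain_le {F : E →ₗ.[ℂ] K} {T : E →ₗ.[ℂ] E} (h : IsCompatible F T) :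
    formDomain T ≤ F.domain := by
  obtain ⟨C, -, hC⟩ := h
  rintro _ ⟨f, rfl⟩
  exact (hC f).1

theorem map_mem_regEigenspace {F : E →ₗ.[ℂ] K} {H : E →ₗ.[ℂ] E} (hH : IsSelfAdjoint H) {a : ℝ}
    (f : F.domain) (hf : (f : E) ∈ eigenspace H (a : ℂ)) : F f ∈ regEigenspace F H a := by
  simp only [regEigenspace, Submodule.mem_iInf]
  intro O ha
  refine Submodule.le_topologicalClosure _ ⟨f, ⟨f, ?_⟩, rfl⟩
  exact spectralProj_apply_of_mem (eigenspace_le_spectralSubspace hH ha hf)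

/-- `F` embeds the eigenspace linearly into `regEigenspace`, its kernel being zero. -/
theorem finiteDimensional_eigenspace {F : E →ₗ.[ℂ] K} (hF : IsRigging F) {H : E →ₗ.[ℂ] E}
    (hH : IsSelfAdjoint H) {a : ℝ} (hle : eigenspace H (a : ℂ) ≤ F.domain)
    (hfin : FiniteDimensional ℂ (regEigenspace F H a)) :
    FiniteDimensional ℂ (eigenspace H (a : ℂ)) := by
  let G : eigenspace H (a : ℂ) →ₗ[ℂ] regEigenspace F H a :=
    (F.toFun.comp (Submodule.inclusion hle)).codRestrict _ fun f =>
      map_mem_regEigenspace hH ⟨f, hle f.2⟩ f.2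
  refine FiniteDimensional.of_injective G ((injective_iff_map_eq_zero G).mpr fun f hf => ?_)
  have h : (⟨f, hle f.2⟩ : F.domain) = 0 := hF.ker_eq_zero _ (congrArg Subtype.val hf)
  exact Subtype.ext (congrArg (fun x : F.domain => (x : E)) h)

end Rigging

end RiggedHilbert

theorem mainTheorem6 {E : Type*} [NormedAddCommGroup E] [InnerProductSpace ℂ E] [CompleteSpace E]
    {K : Type*} [NormedAddCommGroup K] [InnerProductSpace ℂ K] [CompleteSpace K]
    (F : E →ₗ.[ℂ] K) (hF : RiggedHilbert.IsRigging F)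
    (H₀ : E →ₗ.[ℂ] E) (hH₀ : IsSelfAdjoint H₀) (hFH₀ : RiggedHilbert.IsCompatible F H₀) (a : ℝ) :
    (∀ H ∈ RiggedHilbert.affineSpace F H₀,
      ¬ FiniteDimensional ℂ (RiggedHilbert.eigenspace H (a : ℂ)) →
        (∀ f ∈ RiggedHilbert.eigenspace H (a : ℂ),
          ∃ hf : f ∈ F.domain, F ⟨f, hf⟩ ∈ RiggedHilbert.regEigenspace F H a) ∧
        ¬ FiniteDimensional ℂ (RiggedHilbert.regEigenspace F H a)) ∧
    (RiggedHilbert.IsISingular F H₀ a → RiggedHilbert.IsFSingular F H₀ a) := by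
  have key : ∀ H ∈ RiggedHilbert.affineSpace F H₀,
      ¬ FiniteDimensional ℂ (RiggedHilbert.eigenspace H (a : ℂ)) →
        (∀ f ∈ RiggedHilbert.eigenspace H (a : ℂ),
          ∃ hf : f ∈ F.domain, F ⟨f, hf⟩ ∈ RiggedHilbert.regEigenspace F H a) ∧
        ¬ FiniteDimensional ℂ (RiggedHilbert.regEigenspace F H a) := by
    rintro H ⟨J, -, hJ⟩ hinf
    have hle : RiggedHilbert.eigenspace H (a : ℂ) ≤ F.domain := fun f hf =>
      hFH₀.formDomain_le (hJ.domain_le hf.1)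
    exact ⟨fun f hf => ⟨hle hf,
        RiggedHilbert.map_mem_regEigenspace hJ.isSelfAdjoint ⟨f, hle hf⟩ hf⟩,
      fun hfin => hinf
        (RiggedHilbert.finiteDimensional_eigenspace hF hJ.isSelfAdjoint hle hfin)⟩
  exact ⟨key, fun ⟨H, hH, hinf⟩ => ⟨H, hH, (key H hH hinf).2⟩⟩
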